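/- \textbf{Definitions.} A \emph{subordination} $S\colon A\to B$ between boolean algebras is a relation $S\subseteq A\times B$ such that (S1) $0\,S\,0$ and $1\,S\,1$; (S2) $a,b\,S\,c$ implies $(a\vee b)\,S\,c$; (S3) $a\,S\,c,d$ implies $a\,S\,(c\wedge d)$; (S4) $a\le b\,S\,c\le d$ implies $a\,S\,d$. An \emph{$\mathsf{S5}$-subordination algebra} is a pair $\mathbf B=(B,S)$ where $B$ is a boolean algebra and $S$ is a subordination on $B$ such that (S5) $a\,S\,b$ implies $a\le b$; (S6) $a\,S\,b$ implies $\neg b\,S\,\neg a$; (S7) $a\,S\,b$ implies $a\,S\,c\,S\,b$ for some $c$. It is a \emph{de Vries algebra} if $B$ is complete and (S8) each $a\ne0$ admits $b\neq 0$ with $b\,S\,a$. A subordination $T\colon(B_1,S_1)\to(B_2,S_2)$ is \emph{compatible} if $T\circ S_1=T=S_2\circ T$; writing $b\,\widehat T\,a$ for $\neg a\,T\,\neg b$, it is \emph{continuous} if for all $b_1\,S_2\,b_2$ there is $a\in\widehat T[b_1]$ with $\widehat T[b_2]\subseteq S_1[a]$. Let $\mathsf{SubS5^S}$ be the category of $\mathsf{S5}$-subordination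 algebras and compatible subordinations, with relational composition and with $S$ as the identity of $(B,S)$; let $\mathsf{DeV^S}$ be its full subcategory of de Vries algebras, with inclusion $\Delta$; let $\mathsf{SubS5^{CS}}$ and $\mathsf{DeV^{CS}}$ be the wide subcategories of $\mathsf{SubS5^S}$ and $\mathsf{DeV^S}$ whose morphisms are the continuous compatible subordinations. In a frame write $a^*$ for the pseudocomplement of $a$, and $a\prec b$ if $a^*\vee b=1$. A frame is \emph{compact regular} if $1$ is compact and $a=\bigvee\{x\mid x\prec a\}$ for every $a$. Let $\mathsf{KRFrm^P}$ be the category of compact regular frames and preframe homomorphisms (maps preserving finite meets and directed joins). A preframe homomorphism $\Box\colon L\to M$ is a \emph{$\mathsf c$-morphism} if there is a map $\Diamond\colon L\to M$ preserving arbitrary joins with $\Box(a\vee b)\le\Box a\vee\Diamond b$ and $\Box a\wedge\Diamond b\le\Diamond(a\wedge b)$ for all $a,b\in L$; let $\mathsf{KRFrm^C}$ be the wide subcategory of $\mathsf{KRFrm^P}$ whose morphisms are the $\mathsf c$-morphisms. Let $\mathcal{RI}\colon\mathsf{SubS5^S}\to\mathsf{KRFrm^P}$ be the contravariant functor sending $(B,S)$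 to the frame (under inclusion) of its \emph{round ideals}, that is, ideals $I$ such that each $a\in I$ has some $b\in I$ with $a\,S\,b$, and sending $T\colon \mathbf B_1\to \mathbf B_2$ to $I\mapsto T^{-1}[I]$. Let $\mathfrak B\colon\mathsf{KRFrm^P}\to\mathsf{DeV^S}$ be the contravariant functor sending $L$ to $\{a\in L\mid a=a^{**}\}$ with the restriction of $\prec$, and $\Box\colon L\to M$ to the relation $\mathfrak B(\Box)\colon\mathfrak B M\to\mathfrak B L$ given by $b\,\mathfrak B(\Box)\,a$ iff $b\prec\Box a$. \textbf{Theorem.} \begin{enumerate} \item The functors $\mathcal{RI}$ and $\Delta\circ\mathfrak B$, together with natural isomorphisms whose components are $Q_{\mathbf B}\colon\mathbf B\to\mathfrak B(\mathcal{RI}(\mathbf B))$, $a\,Q_{\mathbf B}\,I$ iff $a\in I$, and $f_L\colon L\to\mathcal{RI}(\mathfrak B L)$, $f_L(a)=\{b\in \mathfrak B L\mid b\prec a\}$, form a dual equivalence between $\mathsf{SubS5^S}$ and $\mathsf{KRFrm^P}$, and this dual equivalence restricts to a dual equivalence between the wide subcategories $\mathsf{SubS5^{CS}}$ and $\mathsf{KRFrm^C}$.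 \item The functors $\mathcal{RI}\circ\Delta$ and $\mathfrak B$, together with the natural isomorphisms with the same components, form a dual equivalence between $\mathsf{DeV^S}$ and $\mathsf{KRFrm^P}$, and this dual equivalence restricts to a dual equivalence between the wide subcategories $\mathsf{DeV^{CS}}$ and $\mathsf{KRFrm^C}$. \end{enumerate} Here a dual equivalence \emph{restricts} to wide subcategories if both functors map morphisms of one subcategory to morphisms of the other, and the restricted functors, with the same unit and counit, form a dual equivalence of the subcategories. -/

import Mathlib

open CategoryTheory Opposite

universe u v w v' w' v₁ w₁ v₂ w₂

namespace S5Sub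

/-! ### Subordinations -/

/-- A subordination `S : A → B` between boolean algebras. -/
structure IsSubordination {A : Type u} {B : Type v} [BooleanAlgebra A] [BooleanAlgebra B]
    (S : A → B → Prop) : Prop where
  bot_bot : S ⊥ ⊥
  top_top : S ⊤ ⊤
  sup_left : ∀ a b c, S a c → S b c → S (a ⊔ b) c
  inf_right : ∀ a c d, S a c → S a d → S a (c ⊓ d)
  mono : ∀ a b c d, a ≤ b → S b c → c ≤ d → S a d

/-- An `S5`-subordination on a boolean algebra. -/
structure IsS5 {B : Type u} [BooleanAlgebra B] (S : B → B → Prop) : Prop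
    extends IsSubordination S where
  le : ∀ a b, S a b → a ≤ b
  compl : ∀ a b, S a b → S bᶜ aᶜ
  interpolate : ∀ a b, S a b → ∃ c, S a c ∧ S c b

/-- `S5`-subordination algebras `(B, S)`: the objects of the category `SubS5^S`. -/
structure SubS5 : Type (u + 1) where
  carrier : Type u
  [booleanAlgebra : BooleanAlgebra carrier]
  S : carrier → carrier → Prop
  isS5 : IsS5 S

instance : CoeSort SubS5.{u} (Type u) := ⟨SubS5.carrier⟩

instance (B : SubS5.{u}) : BooleanAlgebra B := B.booleanAlgebra

/-- Compatible subordinations `T : A → B`, that is, subordinations such that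
`T ∘ S_A = T = S_B ∘ T`. (`Relation.Comp r p` is "first `r`, then `p`".) -/
@[ext]
structure SubS5.Hom (A B : SubS5.{u}) where
  rel : A → B → Prop
  isSubordination : IsSubordination rel
  comp_left : Relation.Comp A.S rel = rel
  comp_right : Relation.Comp rel B.S = rel

theorem comp_isSubordination {A B C : Type u} [BooleanAlgebra A] [BooleanAlgebra B]
    [BooleanAlgebra C] {T : A → B → Prop} {U : B → C → Prop}
    (hT : IsSubordination T) (hU : IsSubordination U) :
    IsSubordination (Relation.Comp T U) where
  bot_bot := ⟨⊥, hT.bot_bot, hU.bot_bot⟩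
  top_top := ⟨⊤, hT.top_top, hU.top_top⟩
  sup_left := by
    rintro a b c ⟨x, hx, hx'⟩ ⟨y, hy, hy'⟩
    exact ⟨x ⊔ y, hT.sup_left _ _ _ (hT.mono _ _ _ _ le_rfl hx le_sup_left)
      (hT.mono _ _ _ _ le_rfl hy le_sup_right), hU.sup_left _ _ _ hx' hy'⟩
  inf_right := by
    rintro a c d ⟨x, hx, hx'⟩ ⟨y, hy, hy'⟩
    exact ⟨x ⊓ y, hT.inf_right _ _ _ hx hy, hU.inf_right _ _ _
      (hU.mono _ _ _ _ inf_le_left hx' le_rfl) (hU.mono _ _ _ _ inf_le_right hy' le_rfl)⟩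
  mono := by
    rintro a b c d hab ⟨x, hx, hx'⟩ hcd
    exact ⟨x, hT.mono _ _ _ _ hab hx le_rfl, hU.mono _ _ _ _ le_rfl hx' hcd⟩

theorem IsS5.comp_self {B : Type u} [BooleanAlgebra B] {S : B → B → Prop} (h : IsS5 S) :
    Relation.Comp S S = S := by
  funext a b
  refine propext ⟨?_, h.interpolate a b⟩
  rintro ⟨c, hac, hcb⟩
  exact h.mono _ _ _ _ (h.le _ _ hac) hcb le_rfl

/-- The category `SubS5^S`: the identity of `(B, S)` is `S`, composition is relational. -/
instance : Category SubS5.{u} where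
  Hom := SubS5.Hom
  id B := ⟨B.S, B.isS5.toIsSubordination, B.isS5.comp_self, B.isS5.comp_self⟩
  comp T U :=
    { rel := Relation.Comp T.rel U.rel
      isSubordination := comp_isSubordination T.isSubordination U.isSubordination
      comp_left := by rw [← Relation.comp_assoc, T.comp_left]
      comp_right := by rw [Relation.comp_assoc, U.comp_right] }
  id_comp T := SubS5.Hom.ext T.comp_left
  comp_id T := SubS5.Hom.ext T.comp_right
  assoc _ _ _ := SubS5.Hom.ext Relation.comp_assoc

/-- De Vries algebras: compingent algebras whose boolean algebra is complete. -/
def IsDeVries : ObjectProperty SubS5.{u} := fun B =>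
  (∀ a : B, a ≠ ⊥ → ∃ b : B, b ≠ ⊥ ∧ B.S b a) ∧ ∀ s : Set B, ∃ a : B, IsLUB s a

/-- `DeV^S`, the full subcategory of `SubS5^S` on the de Vries algebras. -/
abbrev DeVS : Type (u + 1) := IsDeVries.{u}.FullSubcategory

/-- The inclusion `Δ : DeV^S ⥤ SubS5^S`. -/
abbrev inclΔ : DeVS.{u} ⥤ SubS5.{u} := IsDeVries.{u}.ι

/-- The relation `T̂ : B → A`, given by `b T̂ a` iff `¬a T ¬b`. -/
def hat {A B : Type u} [BooleanAlgebra A] [BooleanAlgebra B] (T : A → B → Prop) :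
    B → A → Prop := fun b a => T aᶜ bᶜ

/-- Continuity of a compatible subordination `T : A → B`: whenever `b₁ S_B b₂` there is
`a ∈ T̂[b₁]` with `T̂[b₂] ⊆ S_A[a]`. -/
def IsContinuous : MorphismProperty SubS5.{u} := fun A B T =>
  ∀ b₁ b₂ : B, B.S b₁ b₂ →
    ∃ a : A, hat T.rel b₁ a ∧ ∀ c : A, hat T.rel b₂ c → A.S a c

instance : IsContinuous.{u}.IsMultiplicative where
  id_mem B := by
    intro b₁ b₂ h
    obtain ⟨c, h₁, h₂⟩ := B.isS5.interpolate _ _ h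
    refine ⟨c, B.isS5.compl _ _ h₁, fun d hd => ?_⟩
    have hd' := B.isS5.compl _ _ hd
    rw [compl_compl, compl_compl] at hd'
    exact B.isS5.mono _ _ _ _ (B.isS5.le _ _ h₂) hd' le_rfl
  comp_mem := by
    intro A B C T U hT hU c₁ c₂ h
    obtain ⟨c, h₁, h₂⟩ := C.isS5.interpolate _ _ h
    obtain ⟨b₁, hb₁, hb₁'⟩ := hU _ _ h₁
    obtain ⟨b₂, hb₂, hb₂'⟩ := hU _ _ h₂
    obtain ⟨a, ha, ha'⟩ := hT _ _ (hb₁' _ hb₂)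
    refine ⟨a, ⟨b₁ᶜ, ha, hb₁⟩, ?_⟩
    rintro d ⟨b, hdb, hbc⟩
    refine ha' d (T.isSubordination.mono _ _ _ _ le_rfl hdb ?_)
    have hb : hat U.rel c₂ bᶜ := by
      change U.rel bᶜᶜ c₂ᶜ
      rwa [compl_compl]
    exact le_compl_comm.mp (B.isS5.le _ _ (hb₂' _ hb))

/-- `SubS5^CS`: the wide subcategory of `SubS5^S` on the continuous compatible subordinations. -/
abbrev SubS5CS : Type (u + 1) := WideSubcategory IsContinuous.{u}

/-- Continuity of morphisms of `DeV^S`. -/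
abbrev IsContinuousDeV : MorphismProperty DeVS.{u} := fun _ _ T => IsContinuous T.hom

instance : IsContinuousDeV.{u}.IsMultiplicative where
  id_mem B := IsContinuous.{u}.id_mem B.obj
  comp_mem T U hT hU := IsContinuous.{u}.comp_mem T.hom U.hom hT hU

/-- `DeV^CS`: the wide subcategory of `DeV^S` on the continuous compatible subordinations. -/
abbrev DeVCS : Type (u + 1) := WideSubcategory IsContinuousDeV.{u}

/-! ### Compact regular frames -/

/-- The well-inside relation `a ≺ b` of a frame: `a* ∨ b = 1`. -/
def WellInside {L : Type u} [Order.Frame L] (a b : L) : Prop := aᶜ ⊔ b = ⊤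

/-- Compact regular frames. -/
structure IsCompactRegular (L : Type u) [Order.Frame L] : Prop where
  compact : IsCompactElement (⊤ : L)
  regular : ∀ a : L, sSup {x | WellInside x a} = a

/-- Compact regular frames: the objects of the category `KRFrm^P`. -/
structure KRFrmP : Type (u + 1) where
  carrier : Type u
  [frame : Order.Frame carrier]
  isCompactRegular : IsCompactRegular carrier

instance : CoeSort KRFrmP.{u} (Type u) := ⟨KRFrmP.carrier⟩

instance (L : KRFrmP.{u}) : Order.Frame L := L.frame

/-- Preframe homomorphisms: maps preserving finite meets and (nonempty) directed joins. -/
@[ext]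
structure PreframeHom (L M : Type u) [Order.Frame L] [Order.Frame M] where
  toFun : L → M
  map_top : toFun ⊤ = ⊤
  map_inf : ∀ a b, toFun (a ⊓ b) = toFun a ⊓ toFun b
  map_sSup : ∀ s : Set L, s.Nonempty → DirectedOn (· ≤ ·) s →
    toFun (sSup s) = sSup (toFun '' s)

theorem PreframeHom.monotone {L M : Type u} [Order.Frame L] [Order.Frame M]
    (f : PreframeHom L M) : Monotone f.toFun := fun a b h => by
  have := f.map_inf a b
  rw [inf_eq_left.mpr h] at this
  exact inf_eq_left.mp this.symm

/-- The category `KRFrm^P` of compact regular frames and preframe homomorphisms. -/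
instance : Category KRFrmP.{u} where
  Hom L M := PreframeHom L M
  id L := ⟨id, rfl, fun _ _ => rfl, fun s _ _ => by simp⟩
  comp f g :=
    { toFun := g.toFun ∘ f.toFun
      map_top := by simp [f.map_top, g.map_top]
      map_inf := by simp [f.map_inf, g.map_inf]
      map_sSup := fun s hs hd => by
        have hd' : DirectedOn (· ≤ ·) (f.toFun '' s) := by
          rintro _ ⟨x, hx, rfl⟩ _ ⟨y, hy, rfl⟩
          obtain ⟨z, hz, hxz, hyz⟩ := hd x hx y hy
          exact ⟨_, ⟨z, hz, rfl⟩, f.monotone hxz, f.monotone hyz⟩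
        simp only [Function.comp_apply]
        rw [f.map_sSup s hs hd, g.map_sSup _ (hs.image _) hd', Set.image_image] }

/-- `c`-morphisms: preframe homomorphisms `□` for which there is a join-preserving `◇` with
`□(a ∨ b) ≤ □a ∨ ◇b` and `□a ∧ ◇b ≤ ◇(a ∧ b)`. -/
def IsCMorphism : MorphismProperty KRFrmP.{u} := fun L M f =>
  ∃ dia : sSupHom L M,
    (∀ a b : L, f.toFun (a ⊔ b) ≤ f.toFun a ⊔ dia b) ∧
    (∀ a b : L, f.toFun a ⊓ dia b ≤ dia (a ⊓ b))

instance : IsCMorphism.{u}.IsMultiplicative where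
  id_mem L := ⟨sSupHom.id L, fun _ _ => le_rfl, fun _ _ => le_rfl⟩
  comp_mem := by
    rintro L M N f g ⟨d, hd, hd'⟩ ⟨e, he, he'⟩
    refine ⟨e.comp d, fun a b => ?_, fun a b => ?_⟩
    · exact (PreframeHom.monotone g (hd a b)).trans (he _ _)
    · exact (he' _ _).trans (OrderHomClass.mono e (hd' a b))

/-- `KRFrm^C`: the wide subcategory of `KRFrm^P` on the `c`-morphisms. -/
abbrev KRFrmC : Type (u + 1) := WideSubcategory IsCMorphism.{u}

/-! ### The frame of round ideals -/

/-- Round ideals of `(B, S)`: ideals `I` such that every `a ∈ I` has some `b ∈ I` with `a S b`. -/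
structure RoundIdeal (B : SubS5.{u}) extends Order.Ideal B where
  round : ∀ a ∈ carrier, ∃ b ∈ carrier, B.S a b

namespace RoundIdeal

variable {B : SubS5.{u}}

instance : SetLike (RoundIdeal B) B where
  coe I := I.carrier
  coe_injective := by
    rintro ⟨I, hI⟩ ⟨J, hJ⟩ h
    have : I = J := SetLike.coe_injective h
    subst this
    rfl

/-- Round ideals are ordered by inclusion. -/
instance : PartialOrder (RoundIdeal B) := .ofSetLike (RoundIdeal B) B

theorem le_def {I J : RoundIdeal B} : I ≤ J ↔ ∀ a ∈ I, a ∈ J := Iff.rfl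

theorem exists_rel (I : RoundIdeal B) {a : B} (h : a ∈ I) : ∃ b ∈ I, B.S a b := I.round a h

theorem mem_of_le (I : RoundIdeal B) {a b : B} (h : a ≤ b) (hb : b ∈ I) : a ∈ I :=
  I.toIdeal.lower h hb

theorem bot_mem (I : RoundIdeal B) : ⊥ ∈ I := Order.Ideal.bot_mem I.toIdeal

theorem sup_mem (I : RoundIdeal B) {a b : B} (ha : a ∈ I) (hb : b ∈ I) : a ⊔ b ∈ I :=
  Order.Ideal.sup_mem (s := I.toIdeal) ha hb

/-- A subset that satisfies the closure conditions gives a round ideal. -/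
def mk' (s : Set B) (hbot : ⊥ ∈ s) (hle : ∀ a b, a ≤ b → b ∈ s → a ∈ s)
    (hsup : ∀ a b, a ∈ s → b ∈ s → a ⊔ b ∈ s) (hround : ∀ a ∈ s, ∃ b ∈ s, B.S a b) :
    RoundIdeal B where
  carrier := s
  lower' := fun a b h ha => hle b a h ha
  nonempty' := ⟨⊥, hbot⟩
  directed' := fun a ha b hb => ⟨a ⊔ b, hsup a b ha hb, le_sup_left, le_sup_right⟩
  round := hround

@[simp]
theorem mem_mk' {s : Set B} {h₁ h₂ h₃ h₄} {a : B} :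
    a ∈ (mk' (B := B) s h₁ h₂ h₃ h₄) ↔ a ∈ s := Iff.rfl

/-- The join of a set of round ideals: the ideal generated by their union. -/
instance : SupSet (RoundIdeal B) where
  sSup F := mk' {a | ∃ t : Finset B, (∀ x ∈ t, ∃ I ∈ F, x ∈ I) ∧ a ≤ t.sup id}
    ⟨∅, by simp, by simp⟩
    (fun a b hab ⟨t, ht, hb⟩ => ⟨t, ht, hab.trans hb⟩)
    (by
      classical
      rintro a b ⟨t, ht, hat⟩ ⟨r, hr, hbr⟩
      refine ⟨t ∪ r, fun x hx => (Finset.mem_union.mp hx).elim (ht x) (hr x), ?_⟩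
      rw [Finset.sup_union]
      exact sup_le_sup hat hbr)
    (by
      classical
      rintro a ⟨t, ht, hat⟩
      have key : ∃ r : Finset B, (∀ x ∈ r, ∃ I ∈ F, x ∈ I) ∧ B.S (t.sup id) (r.sup id) := by
        clear hat
        induction t using Finset.induction_on with
        | empty => exact ⟨∅, by simp, by simpa using B.isS5.bot_bot⟩
        | insert y t _ ih =>
          obtain ⟨r, hr, hr'⟩ := ih fun x hx => ht x (Finset.mem_insert_of_mem hx)
          obtain ⟨I, hI, hyI⟩ := ht y (Finset.mem_insert_self _ _)
          obtain ⟨z, hz, hyz⟩ := I.exists_rel hyI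
          refine ⟨insert z r, fun x hx => ?_, ?_⟩
          · rcases Finset.mem_insert.mp hx with rfl | hx
            · exact ⟨I, hI, hz⟩
            · exact hr x hx
          · rw [Finset.sup_insert, Finset.sup_insert]
            exact B.isS5.sup_left _ _ _ (B.isS5.mono _ _ _ _ le_rfl hyz le_sup_left)
              (B.isS5.mono _ _ _ _ le_rfl hr' le_sup_right)
      obtain ⟨r, hr, hr'⟩ := key
      exact ⟨r.sup id, ⟨r, hr, le_rfl⟩, B.isS5.mono _ _ _ _ hat hr' le_rfl⟩)

theorem mem_sSup {F : Set (RoundIdeal B)} {a : B} :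
    a ∈ sSup F ↔ ∃ t : Finset B, (∀ x ∈ t, ∃ I ∈ F, x ∈ I) ∧ a ≤ t.sup id := Iff.rfl

theorem finset_sup_mem (I : RoundIdeal B) (t : Finset B) (ht : ∀ x ∈ t, x ∈ I) :
    t.sup id ∈ I := by
  classical
  induction t using Finset.induction_on with
  | empty => simpa using I.bot_mem
  | insert y t _ ih =>
    rw [Finset.sup_insert]
    exact I.sup_mem (ht y (Finset.mem_insert_self _ _))
      (ih fun x hx => ht x (Finset.mem_insert_of_mem hx))

theorem isLUB_sSup' (F : Set (RoundIdeal B)) : IsLUB F (sSup F) := by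
  constructor
  · intro I hI a ha
    exact ⟨{a}, by simpa using ⟨I, hI, ha⟩, by simp⟩
  · intro J hJ a ha
    obtain ⟨t, ht, hat⟩ := mem_sSup.mp ha
    refine J.mem_of_le hat (J.finset_sup_mem t fun x hx => ?_)
    obtain ⟨I, hI, hxI⟩ := ht x hx
    exact hJ hI hxI

/-- The intersection of two round ideals. -/
def inter (I J : RoundIdeal B) : RoundIdeal B :=
  mk' {a | a ∈ I ∧ a ∈ J} ⟨I.bot_mem, J.bot_mem⟩
    (fun _ _ h hb => ⟨I.mem_of_le h hb.1, J.mem_of_le h hb.2⟩)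
    (fun _ _ ha hb => ⟨I.sup_mem ha.1 hb.1, J.sup_mem ha.2 hb.2⟩)
    (by
      rintro a ⟨haI, haJ⟩
      obtain ⟨b, hb, hab⟩ := I.exists_rel haI
      obtain ⟨c, hc, hac⟩ := J.exists_rel haJ
      exact ⟨b ⊓ c, ⟨I.mem_of_le inf_le_left hb, J.mem_of_le inf_le_right hc⟩,
        B.isS5.inf_right _ _ _ hab hac⟩)

/-- The improper ideal. -/
def univ : RoundIdeal B :=
  mk' Set.univ trivial (fun _ _ _ _ => trivial) (fun _ _ _ _ => trivial)
    (fun _ _ => ⟨⊤, trivial, B.isS5.mono _ _ _ _ le_top B.isS5.top_top le_rfl⟩)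

instance : CompleteLattice (RoundIdeal B) where
  __ := completeLatticeOfSup (RoundIdeal B) isLUB_sSup'
  inf := inter
  inf_le_left _ _ := fun _ h => h.1
  inf_le_right _ _ := fun _ h => h.2
  le_inf _ _ _ h₁ h₂ _ h := ⟨h₁ h, h₂ h⟩
  top := univ
  le_top _ := fun _ _ => trivial

theorem mem_inf {I J : RoundIdeal B} {a : B} : a ∈ I ⊓ J ↔ a ∈ I ∧ a ∈ J := Iff.rfl

theorem mem_top {a : B} : a ∈ (⊤ : RoundIdeal B) := trivial

theorem le_sSup_mem {F : Set (RoundIdeal B)} {I : RoundIdeal B} (hI : I ∈ F) {a : B}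
    (ha : a ∈ I) : a ∈ sSup F := (isLUB_sSup' F).1 hI ha

/-- The frame `RI(B, S)` of round ideals. -/
instance : Order.Frame (RoundIdeal B) := .ofMinimalAxioms
  { inf_sSup_le_iSup_inf := by
      classical
      intro I F a ha
      obtain ⟨haI, t, ht, hat⟩ := ha
      have h : a ≤ (t.image (a ⊓ ·)).sup id := by
        rw [Finset.sup_image, Function.id_comp]
        change a ≤ t.sup fun x => a ⊓ id x
        rw [← Finset.sup_inf_distrib_left]
        exact le_inf le_rfl hat
      refine mem_of_le _ h (finset_sup_mem _ _ fun x hx => ?_)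
      obtain ⟨y, hy, rfl⟩ := Finset.mem_image.mp hx
      obtain ⟨J, hJ, hyJ⟩ := ht y hy
      exact (le_iSup₂_of_le (f := fun b (_ : b ∈ F) => I ⊓ b) J hJ le_rfl)
        ⟨I.mem_of_le inf_le_left haI, J.mem_of_le inf_le_right hyJ⟩ }

theorem mem_sup {I J : RoundIdeal B} {a b : B} (ha : a ∈ I) (hb : b ∈ J) : a ⊔ b ∈ I ⊔ J :=
  sup_mem _ ((le_sup_left : I ≤ I ⊔ J) ha) ((le_sup_right : J ≤ I ⊔ J) hb)

theorem eq_top_of_top_mem {I : RoundIdeal B} (h : ⊤ ∈ I) : I = ⊤ :=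
  top_le_iff.mp fun _ _ => I.mem_of_le le_top h

/-- The round ideal `T⁻¹[I]` for a compatible subordination `T : A → B`. -/
def preimage {A : SubS5.{u}} (T : A ⟶ B) (I : RoundIdeal B) : RoundIdeal A :=
  mk' {a | ∃ b ∈ I, T.rel a b} ⟨⊥, I.bot_mem, T.isSubordination.bot_bot⟩
    (fun _ _ h ⟨b, hb, hT⟩ => ⟨b, hb, T.isSubordination.mono _ _ _ _ h hT le_rfl⟩)
    (fun _ _ ⟨b, hb, hT⟩ ⟨c, hc, hT'⟩ => ⟨b ⊔ c, I.sup_mem hb hc,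
      T.isSubordination.sup_left _ _ _ (T.isSubordination.mono _ _ _ _ le_rfl hT le_sup_left)
        (T.isSubordination.mono _ _ _ _ le_rfl hT' le_sup_right)⟩)
    (by
      rintro a ⟨b, hb, hT⟩
      rw [← T.comp_left] at hT
      obtain ⟨c, hac, hcb⟩ := hT
      exact ⟨c, ⟨b, hb, hcb⟩, hac⟩)

theorem mem_preimage {A : SubS5.{u}} {T : A ⟶ B} {I : RoundIdeal B} {a : A} :
    a ∈ preimage T I ↔ ∃ b ∈ I, T.rel a b := Iff.rfl

/-- The principal round ideal `S⁻¹[b]`. -/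
def below (b : B) : RoundIdeal B :=
  mk' {a | B.S a b} (B.isS5.mono _ _ _ _ le_rfl B.isS5.bot_bot bot_le)
    (fun _ _ h hb => B.isS5.mono _ _ _ _ h hb le_rfl)
    (fun _ _ h h' => B.isS5.sup_left _ _ _ h h')
    (fun _ h => by
      obtain ⟨c, hac, hcb⟩ := B.isS5.interpolate _ b h
      exact ⟨c, hcb, hac⟩)

theorem mem_sSup_directed {F : Set (RoundIdeal B)} (hF : F.Nonempty)
    (hd : DirectedOn (· ≤ ·) F) {a : B} : a ∈ sSup F ↔ ∃ I ∈ F, a ∈ I := by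
  classical
  refine ⟨?_, fun ⟨I, hI, ha⟩ => le_sSup_mem hI ha⟩
  rintro ⟨t, ht, hat⟩
  suffices h : ∃ I ∈ F, t.sup id ∈ I by
    obtain ⟨I, hI, h⟩ := h
    exact ⟨I, hI, I.mem_of_le hat h⟩
  clear hat
  induction t using Finset.induction_on with
  | empty =>
    obtain ⟨I, hI⟩ := hF
    exact ⟨I, hI, by simpa using I.bot_mem⟩
  | insert y t _ ih =>
    obtain ⟨I, hI, h⟩ := ih fun x hx => ht x (Finset.mem_insert_of_mem hx)
    obtain ⟨J, hJ, hy⟩ := ht y (Finset.mem_insert_self _ _)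
    obtain ⟨K, hK, hIK, hJK⟩ := hd I hI J hJ
    refine ⟨K, hK, ?_⟩
    rw [Finset.sup_insert]
    exact K.sup_mem (hJK hy) (hIK h)

theorem below_wellInside {J : RoundIdeal B} {b : B} (hb : b ∈ J) : WellInside (below b) J := by
  obtain ⟨c, hc, hbc⟩ := J.exists_rel hb
  have h : cᶜ ∈ (below b)ᶜ := by
    have hle : below bᶜ ≤ (below b)ᶜ := by
      rw [le_compl_iff_disjoint_right, disjoint_iff_inf_le]
      rintro x ⟨hx, hx'⟩
      have : x ≤ b ⊓ bᶜ := le_inf (B.isS5.le _ _ hx') (B.isS5.le _ _ hx)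
      rw [inf_compl_eq_bot] at this
      exact mem_of_le _ this (bot_mem _)
    exact hle (B.isS5.compl _ _ hbc)
  refine eq_top_of_top_mem ?_
  have := mem_sup h hc
  rwa [compl_sup_eq_top] at this

theorem isCompactRegular (B : SubS5.{u}) : IsCompactRegular (RoundIdeal B) where
  compact := by
    rw [CompleteLattice.isCompactElement_iff_le_of_directed_sSup_le]
    intro F hF hd h
    obtain ⟨I, hI, hI'⟩ := (mem_sSup_directed hF hd).mp (h (mem_top (a := ⊤)))
    exact ⟨I, hI, (eq_top_of_top_mem hI').ge⟩
  regular J := by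
    refine le_antisymm (sSup_le fun I hI => ?_) fun a ha => ?_
    · have h : I ⊓ (Iᶜ ⊔ J) = I := by rw [show Iᶜ ⊔ J = ⊤ from hI, inf_top_eq]
      rw [inf_sup_left, inf_compl_self, bot_sup_eq] at h
      exact inf_eq_left.mp h
    · obtain ⟨b, hb, hab⟩ := J.exists_rel ha
      exact le_sSup_mem (I := below b) (below_wellInside hb) hab

end RoundIdeal

/-- The contravariant functor `RI : SubS5^S → KRFrm^P`, sending `(B, S)` to its frame of round
ideals and `T : A → B` to `I ↦ T⁻¹[I]`. -/
def RI : SubS5.{u}ᵒᵖ ⥤ KRFrmP.{u} where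
  obj B := ⟨RoundIdeal B.unop, RoundIdeal.isCompactRegular B.unop⟩
  map {B A} T :=
    { toFun := RoundIdeal.preimage T.unop
      map_top := RoundIdeal.eq_top_of_top_mem
        ⟨⊤, RoundIdeal.mem_top, T.unop.isSubordination.top_top⟩
      map_inf := fun I J => by
        refine SetLike.ext fun a => ⟨?_, ?_⟩
        · rintro ⟨b, hb, hT⟩
          exact ⟨⟨b, hb.1, hT⟩, ⟨b, hb.2, hT⟩⟩
        · rintro ⟨⟨b, hb, hT⟩, ⟨c, hc, hT'⟩⟩
          exact ⟨b ⊓ c, ⟨I.mem_of_le inf_le_left hb, J.mem_of_le inf_le_right hc⟩,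
            T.unop.isSubordination.inf_right _ _ _ hT hT'⟩
      map_sSup := fun F hF hd => by
        have hd' : DirectedOn (· ≤ ·) (RoundIdeal.preimage T.unop '' F) := by
          rintro _ ⟨I, hI, rfl⟩ _ ⟨J, hJ, rfl⟩
          obtain ⟨K, hK, hIK, hJK⟩ := hd I hI J hJ
          exact ⟨_, ⟨K, hK, rfl⟩, fun _ ⟨b, hb, h⟩ => ⟨b, hIK hb, h⟩,
            fun _ ⟨b, hb, h⟩ => ⟨b, hJK hb, h⟩⟩
        refine SetLike.ext fun a => ?_
        rw [RoundIdeal.mem_sSup_directed (hF.image _) hd', RoundIdeal.mem_preimage]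
        constructor
        · rintro ⟨b, hb, hT⟩
          obtain ⟨I, hI, hbI⟩ := (RoundIdeal.mem_sSup_directed hF hd).mp hb
          exact ⟨_, ⟨I, hI, rfl⟩, b, hbI, hT⟩
        · rintro ⟨_, ⟨I, hI, rfl⟩, b, hb, hT⟩
          exact ⟨b, RoundIdeal.le_sSup_mem hI hb, hT⟩ }
  map_id B := by
    refine PreframeHom.ext (funext fun I => SetLike.ext fun a => ⟨?_, I.exists_rel⟩)
    rintro ⟨b, hb, hab⟩
    exact I.mem_of_le (B.unop.isS5.le _ _ hab) hb
  map_comp T U := by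
    refine PreframeHom.ext (funext fun I => SetLike.ext fun a => ⟨?_, ?_⟩)
    · rintro ⟨b, hb, c, hc, hc'⟩
      exact ⟨c, ⟨b, hb, hc'⟩, hc⟩
    · rintro ⟨c, ⟨b, hb, hc'⟩, hc⟩
      exact ⟨b, hb, c, hc, hc'⟩

/-! ### Booleanization -/

namespace WellInside

variable {L : Type u} [Order.Frame L] {a b c d : L}

theorem le (h : WellInside a b) : a ≤ b := by
  have h' : a ⊓ (aᶜ ⊔ b) = a := by rw [show aᶜ ⊔ b = ⊤ from h, inf_top_eq]
  rw [inf_sup_left, inf_compl_self, bot_sup_eq] at h'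
  exact inf_eq_left.mp h'

theorem mono (hab : a ≤ b) (h : WellInside b c) (hcd : c ≤ d) : WellInside a d :=
  top_le_iff.mp (h.ge.trans (sup_le_sup (compl_le_compl hab) hcd))

theorem bot_left : WellInside (⊥ : L) a := by simp [WellInside]

theorem top_right : WellInside a (⊤ : L) := by simp [WellInside]

theorem sup_left (h : WellInside a c) (h' : WellInside b c) : WellInside (a ⊔ b) c := by
  unfold WellInside at *
  rw [compl_sup, sup_inf_right, h, h', inf_top_eq]

theorem inf_right (h : WellInside a b) (h' : WellInside a c) : WellInside a (b ⊓ c) := by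
  unfold WellInside at *
  rw [sup_inf_left, h, h', inf_top_eq]

theorem compl_compl_left (h : WellInside a b) : WellInside aᶜᶜ b := by
  unfold WellInside at *
  rwa [compl_compl_compl]

theorem compl (h : WellInside a b) : WellInside bᶜ aᶜ := by
  unfold WellInside at *
  exact top_le_iff.mp (h.ge.trans (sup_le le_sup_right (le_compl_compl.trans le_sup_left)))

end WellInside

namespace IsCompactRegular

variable {L : Type u} [Order.Frame L]

theorem exists_of_wellInside_sSup (hL : IsCompactRegular L) {b : L} {D : Set L}
    (hD : D.Nonempty) (hd : DirectedOn (· ≤ ·) D) (h : WellInside b (sSup D)) :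
    ∃ d ∈ D, WellInside b d := by
  have hc := (CompleteLattice.isCompactElement_iff_le_of_directed_sSup_le L ⊤).mp hL.compact
    ((bᶜ ⊔ ·) '' D) (hD.image _) (by
      rintro _ ⟨x, hx, rfl⟩ _ ⟨y, hy, rfl⟩
      obtain ⟨z, hz, hxz, hyz⟩ := hd x hx y hy
      exact ⟨_, ⟨z, hz, rfl⟩, sup_le_sup_left hxz _, sup_le_sup_left hyz _⟩) (by
      refine h.ge.trans (sup_le ?_ (sSup_le fun x hx => ?_))
      · obtain ⟨x, hx⟩ := hD
        exact le_sSup_of_le ⟨x, hx, rfl⟩ le_sup_left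
      · exact le_sSup_of_le ⟨x, hx, rfl⟩ le_sup_right)
  obtain ⟨_, ⟨d, hd, rfl⟩, h'⟩ := hc
  exact ⟨d, hd, top_le_iff.mp h'⟩

theorem nonempty_regular (a : L) :
    {x : L | Heyting.IsRegular x ∧ WellInside x a}.Nonempty :=
  ⟨⊥, Heyting.isRegular_bot, WellInside.bot_left⟩

theorem directed_regular (a : L) :
    DirectedOn (· ≤ ·) {x : L | Heyting.IsRegular x ∧ WellInside x a} := by
  rintro x ⟨_, hx⟩ y ⟨_, hy⟩
  exact ⟨(x ⊔ y)ᶜᶜ, ⟨Heyting.isRegular_compl _, (hx.sup_left hy).compl_compl_left⟩,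
    le_sup_left.trans le_compl_compl, le_sup_right.trans le_compl_compl⟩

theorem sSup_regular (hL : IsCompactRegular L) (a : L) :
    sSup {x : L | Heyting.IsRegular x ∧ WellInside x a} = a := by
  refine le_antisymm (sSup_le fun x hx => hx.2.le) ?_
  conv_lhs => rw [← hL.regular a]
  exact sSup_le fun x hx => le_compl_compl.trans
    (le_sSup ⟨Heyting.isRegular_compl _, WellInside.compl_compl_left hx⟩)

theorem interpolate (hL : IsCompactRegular L) {a b : L} (h : WellInside a b) :
    ∃ c, Heyting.IsRegular c ∧ WellInside a c ∧ WellInside c b := by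
  rw [← hL.sSup_regular b] at h
  obtain ⟨c, hc, hac⟩ := hL.exists_of_wellInside_sSup (nonempty_regular b) (directed_regular b) h
  exact ⟨c, hc.1, hac, hc.2⟩

theorem interpolate_map {M : Type u} [Order.Frame M] (hL : IsCompactRegular L)
    (hM : IsCompactRegular M) (f : PreframeHom L M) {b : M} {a : L}
    (h : WellInside b (f.toFun a)) :
    ∃ c, Heyting.IsRegular c ∧ WellInside b (f.toFun c) ∧ WellInside c a := by
  rw [← hL.sSup_regular a, f.map_sSup _ (nonempty_regular a) (directed_regular a)] at h
  obtain ⟨_, ⟨c, hc, rfl⟩, hbc⟩ := hM.exists_of_wellInside_sSup ((nonempty_regular a).image _) (by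
    rintro _ ⟨x, hx, rfl⟩ _ ⟨y, hy, rfl⟩
    obtain ⟨z, hz, hxz, hyz⟩ := directed_regular a x hx y hy
    exact ⟨_, ⟨z, hz, rfl⟩, f.monotone hxz, f.monotone hyz⟩) h
  exact ⟨c, hc.1, hbc, hc.2⟩

end IsCompactRegular

/-- The booleanization `{a | a = a**}` of a compact regular frame, with the restriction of the
well-inside relation. -/
def boolAlg (L : KRFrmP.{u}) : SubS5.{u} where
  carrier := Heyting.Regular L
  S a b := WellInside a.val b.val
  isS5 :=
    { bot_bot := WellInside.bot_left
      top_top := WellInside.top_right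
      sup_left := fun _ _ _ h h' => (h.sup_left h').compl_compl_left
      inf_right := fun _ _ _ h h' => h.inf_right h'
      mono := fun _ _ _ _ h h' h'' => h'.mono h h''
      le := fun _ _ h => h.le
      compl := fun _ _ h => h.compl
      interpolate := fun _ _ h => by
        obtain ⟨c, hc, h₁, h₂⟩ := L.isCompactRegular.interpolate h
        exact ⟨⟨c, hc⟩, h₁, h₂⟩ }

theorem boolAlg_isDeVries (L : KRFrmP.{u}) : IsDeVries (boolAlg L) := by
  refine ⟨fun a ha => ?_, fun s => ?_⟩
  · by_contra hcon
    refine ha (Heyting.Regular.coe_injective (le_bot_iff.mp ?_))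
    rw [← L.isCompactRegular.sSup_regular a.val]
    refine sSup_le fun x hx => ?_
    by_contra hx'
    exact hcon ⟨⟨x, hx.1⟩, fun h => hx' (congrArg Heyting.Regular.val h).le, hx.2⟩
  · refine ⟨⟨(sSup (Heyting.Regular.val '' s))ᶜᶜ, Heyting.isRegular_compl _⟩, ?_, ?_⟩
    · intro a ha
      exact (le_sSup (Set.mem_image_of_mem _ ha)).trans
        (le_compl_compl : _ ≤ (sSup (Heyting.Regular.val '' s))ᶜᶜ)
    · intro b hb
      have h : sSup (Heyting.Regular.val '' s) ≤ b.val := by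
        refine sSup_le ?_
        rintro _ ⟨a, ha, rfl⟩
        exact hb ha
      exact (compl_le_compl (compl_le_compl h)).trans b.prop.le

/-- The relation `b ≺ □ a` between booleanizations. -/
def boolMap {L M : KRFrmP.{u}} (f : L ⟶ M) : boolAlg M ⟶ boolAlg L where
  rel b a := WellInside b.val (PreframeHom.toFun f a.val)
  isSubordination :=
    { bot_bot := WellInside.bot_left
      top_top := by
        change WellInside _ (PreframeHom.toFun f ⊤)
        rw [PreframeHom.map_top f]
        exact WellInside.top_right
      sup_left := fun _ _ _ h h' => (h.sup_left h').compl_compl_left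
      inf_right := fun a c d h h' => by
        change WellInside _ (PreframeHom.toFun f (c.val ⊓ d.val))
        rw [PreframeHom.map_inf f]
        exact h.inf_right h'
      mono := fun _ _ _ _ h h' h'' => h'.mono h (PreframeHom.monotone f h'') }
  comp_left := by
    funext b a
    refine propext ⟨?_, fun h => ?_⟩
    · rintro ⟨c, hbc, hca⟩
      exact hca.mono hbc.le le_rfl
    · obtain ⟨c, hc, h₁, h₂⟩ := M.isCompactRegular.interpolate h
      exact ⟨⟨c, hc⟩, h₁, h₂⟩
  comp_right := by
    funext b a
    refine propext ⟨?_, fun h => ?_⟩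
    · rintro ⟨c, hbc, hca⟩
      exact hbc.mono le_rfl (PreframeHom.monotone f hca.le)
    · obtain ⟨c, hc, h₁, h₂⟩ :=
        L.isCompactRegular.interpolate_map M.isCompactRegular f h
      exact ⟨⟨c, hc⟩, h₁, h₂⟩

/-- The contravariant functor `𝔅 : KRFrm^P → DeV^S`, sending a frame to its booleanization and
`□ : L → M` to the relation `b ≺ □ a`. -/
def boolFunctor : KRFrmP.{u}ᵒᵖ ⥤ DeVS.{u} where
  obj L := ⟨boolAlg L.unop, boolAlg_isDeVries L.unop⟩
  map f := ObjectProperty.homMk (boolMap f.unop)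
  map_id L := ObjectProperty.hom_ext _ (SubS5.Hom.ext rfl)
  map_comp {L M N} f g := by
    refine ObjectProperty.hom_ext _ (SubS5.Hom.ext ?_)
    funext c a
    refine propext ⟨fun h => ?_, ?_⟩
    · obtain ⟨b, hb, h₁, h₂⟩ := M.unop.isCompactRegular.interpolate_map
        L.unop.isCompactRegular f.unop h
      exact ⟨⟨b, hb⟩, h₁, h₂⟩
    · rintro ⟨b, h₁, h₂⟩
      exact h₁.mono le_rfl (PreframeHom.monotone f.unop h₂.le)

/-- The relation `Q_B : B → 𝔅(RI(B))`, given by `a Q_B I` iff `a ∈ I`. -/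
def relQ (B : SubS5.{u}) (a : B) (I : boolAlg (RI.obj (op B))) : Prop :=
  a ∈ (show RoundIdeal B from I.val)

/-- The subset `f_L(a) = {b | b ≺ a}` of the booleanization of `L`. -/
def setF (L : KRFrmP.{u}) (a : L) : Set (boolAlg L) := {b | WellInside b.val a}

/-! ### Restriction of an equivalence along two functors -/

section Restriction

variable {C : Type u} [Category.{v} C] {D : Type w} [Category.{v'} D]
  {C' : Type w'} [Category.{v₁} C'] {D' : Type w₁} [Category.{v₂} D']

/-- An equivalence `e : C ≌ D` restricts to `e' : C' ≌ D'` along `I : C' ⥤ C` and `J : D' ⥤ D`: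
the two functors and the unit and counit of `e'` are the restrictions of those of `e`. -/
structure RestrictsTo (e : C ≌ D) (e' : C' ≌ D') (I : C' ⥤ C) (J : D' ⥤ D) : Prop where
  functor_eq : e'.functor ⋙ J = I ⋙ e.functor
  inverse_eq : e'.inverse ⋙ I = J ⋙ e.inverse
  unit_eq : ∀ X : C', I.map (e'.unit.app X) ≫
    eqToHom ((Functor.congr_obj inverse_eq (e'.functor.obj X)).trans
      (congrArg e.inverse.obj (Functor.congr_obj functor_eq X))) = e.unit.app (I.obj X)
  counit_eq : ∀ Y : D', J.map (e'.counit.app Y) =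
    eqToHom ((Functor.congr_obj functor_eq (e'.inverse.obj Y)).trans
      (congrArg e.functor.obj (Functor.congr_obj inverse_eq Y))) ≫ e.counit.app (J.obj Y)

end Restriction

end S5Sub

/-!
Both composites are computed by interpolation. In a compact regular frame `b ≺ ⋁ D` with `D`
directed already gives `b ≺ d` for some `d ∈ D`, and every element is the directed join of the
regular elements well inside it; this recovers `L` from its regular elements. In the frame of round
ideals `I ≺ J` holds iff `I ≺ S⁻¹[a]` for some `a ∈ J`, so that `I ≺ S⁻¹[a]` defines the inverse
of the relation `a ∈ I`.

Isomorphisms of `SubS5^S` are continuous and isomorphisms of `KRFrm^P` are `c`-morphisms, so the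
unit and the counit restrict as soon as the functors do. For a continuous `T` the required `◇` is
the left adjoint of `I ↦ T̂⁻¹[I]`.
-/

namespace S5Sub

/-! ### Calculus of subordinations -/

namespace IsSubordination

variable {A : Type u} {B : Type v} [BooleanAlgebra A] [BooleanAlgebra B] {T : A → B → Prop}

theorem mono_left (hT : IsSubordination T) {a a' : A} {b : B} (ha : a ≤ a') (h : T a' b) :
    T a b :=
  hT.mono _ _ _ _ ha h le_rfl

theorem mono_right (hT : IsSubordination T) {a : A} {b b' : B} (h : T a b) (hb : b ≤ b') :
    T a b' :=
  hT.mono _ _ _ _ le_rfl h hb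

theorem sup_sup (hT : IsSubordination T) {a a' : A} {b b' : B} (h : T a b) (h' : T a' b') :
    T (a ⊔ a') (b ⊔ b') :=
  hT.sup_left _ _ _ (hT.mono_right h le_sup_left) (hT.mono_right h' le_sup_right)

theorem inf_inf (hT : IsSubordination T) {a a' : A} {b b' : B} (h : T a b) (h' : T a' b') :
    T (a ⊓ a') (b ⊓ b') :=
  hT.inf_right _ _ _ (hT.mono_left inf_le_left h) (hT.mono_left inf_le_right h')

theorem inf_of_sup_of_compl (hT : IsSubordination T) {a a' : A} {b c : B} (h : T a (b ⊔ c))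
    (h' : T a' cᶜ) : T (a ⊓ a') b :=
  hT.mono_right (hT.inf_inf h h') <| by
    rw [inf_sup_right, inf_compl_self, sup_bot_eq]
    exact inf_le_left

end IsSubordination

theorem isSubordination_hat {A B : Type u} [BooleanAlgebra A] [BooleanAlgebra B]
    {T : A → B → Prop} (hT : IsSubordination T) : IsSubordination (hat T) where
  bot_bot := by simpa only [hat, compl_bot] using hT.top_top
  top_top := by simpa only [hat, compl_top] using hT.bot_bot
  sup_left b b' a h h' := by simpa only [hat, compl_sup] using hT.inf_right _ _ _ h h'
  inf_right b a a' h h' := by simpa only [hat, compl_inf] using hT.sup_left _ _ _ h h'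
  mono _ _ _ _ hb h ha := hT.mono _ _ _ _ (compl_le_compl ha) h (compl_le_compl hb)

namespace IsS5

variable {B : Type u} [BooleanAlgebra B] {S : B → B → Prop}

theorem compl_left_comm (hS : IsS5 S) {a b : B} : S aᶜ b ↔ S bᶜ a :=
  ⟨fun h => by simpa only [compl_compl] using hS.compl _ _ h,
    fun h => by simpa only [compl_compl] using hS.compl _ _ h⟩

theorem compl_right_comm (hS : IsS5 S) {a b : B} : S a bᶜ ↔ S b aᶜ :=
  ⟨fun h => by simpa only [compl_compl] using hS.compl _ _ h,
    fun h => by simpa only [compl_compl] using hS.compl _ _ h⟩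

end IsS5

/-! ### Morphisms of `SubS5^S` -/

namespace SubS5

variable {A B : SubS5.{u}}

theorem hom_ext {T U : A ⟶ B} (h : ∀ a b, T.rel a b ↔ U.rel a b) : T = U :=
  Hom.ext (funext₂ fun a b => propext (h a b))

/-- The compatible subordination given by a subordination that interpolates on both sides; the
converse inclusions `T ∘ S ⊆ T` and `S ∘ T ⊆ T` hold for every subordination. -/
def homMk (T : A → B → Prop) (hT : IsSubordination T)
    (hleft : ∀ a b, T a b → ∃ a', A.S a a' ∧ T a' b)
    (hright : ∀ a b, T a b → ∃ b', T a b' ∧ B.S b' b) : A ⟶ B where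
  rel := T
  isSubordination := hT
  comp_left := funext₂ fun a b => propext
    ⟨fun ⟨_, ha, h⟩ => hT.mono_left (A.isS5.le _ _ ha) h, hleft a b⟩
  comp_right := funext₂ fun a b => propext
    ⟨fun ⟨_, h, hb⟩ => hT.mono_right h (B.isS5.le _ _ hb), hright a b⟩

theorem Hom.exists_left (T : A ⟶ B) {a : A} {b : B} (h : T.rel a b) :
    ∃ a', A.S a a' ∧ T.rel a' b := by
  rwa [← T.comp_left] at h

theorem Hom.exists_right (T : A ⟶ B) {a : A} {b : B} (h : T.rel a b) :
    ∃ b', T.rel a b' ∧ B.S b' b := by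
  rwa [← T.comp_right] at h

/-- The relation `T̂` as a compatible subordination in the opposite direction. -/
def hatHom (T : A ⟶ B) : B ⟶ A :=
  homMk (hat T.rel) (isSubordination_hat T.isSubordination)
    (fun b a h => by
      obtain ⟨d, had, hdb⟩ := Hom.exists_right T h
      exact ⟨dᶜ, B.isS5.compl_right_comm.mp hdb, by rwa [hat, compl_compl]⟩)
    (fun b a h => by
      obtain ⟨d, had, hdb⟩ := Hom.exists_left T h
      exact ⟨dᶜ, by rwa [hat, compl_compl], A.isS5.compl_left_comm.mp had⟩)

end SubS5

theorem isContinuous_of_isIso {A B : SubS5.{u}} (T : A ⟶ B) [IsIso T] : IsContinuous T := by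
  intro b₁ b₂ h
  obtain ⟨a, hb₂a, hab₁⟩ : (inv T ≫ T).rel b₂ᶜ b₁ᶜ := by
    rw [IsIso.inv_hom_id]
    exact B.isS5.compl _ _ h
  refine ⟨aᶜ, by rwa [hat, compl_compl], fun c hc => ?_⟩
  have hca : (T ≫ inv T).rel cᶜ a := ⟨b₂ᶜ, hc, hb₂a⟩
  rw [IsIso.hom_inv_id] at hca
  exact A.isS5.compl_left_comm.mp hca

/-! ### Isomorphisms of compact regular frames -/

theorem wellInside_compl_of_sup_eq_top {L : Type u} [Order.Frame L] {a b : L} (h : a ⊔ b = ⊤) :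
    WellInside aᶜ b :=
  top_le_iff.mp (h.ge.trans (sup_le_sup_right le_compl_compl b))

/-- An order isomorphism of frames as a preframe homomorphism. -/
def PreframeHom.ofOrderIso {L M : Type u} [Order.Frame L] [Order.Frame M] (e : L ≃o M) :
    PreframeHom L M where
  toFun := e
  map_top := e.map_top
  map_inf := e.map_inf
  map_sSup s _ _ := by rw [e.map_sSup, sSup_image]

namespace KRFrmP

variable {L M : KRFrmP.{u}}

theorem hom_ext {f g : L ⟶ M} (h : ∀ a, PreframeHom.toFun f a = PreframeHom.toFun g a) : f = g :=
  PreframeHom.ext (funext h)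

/-- An order isomorphism of compact regular frames as an isomorphism of `KRFrm^P`. -/
def isoOfOrderIso (e : L ≃o M) : L ≅ M where
  hom := PreframeHom.ofOrderIso e
  inv := PreframeHom.ofOrderIso e.symm
  hom_inv_id := hom_ext e.symm_apply_apply
  inv_hom_id := hom_ext e.apply_symm_apply

/-- The order isomorphism underlying an isomorphism of `KRFrm^P`. -/
def orderIsoOfIso (i : L ≅ M) : L ≃o M :=
  Equiv.toOrderIso
    { toFun := PreframeHom.toFun i.hom
      invFun := PreframeHom.toFun i.inv
      left_inv := congrFun (congrArg PreframeHom.toFun i.hom_inv_id)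
      right_inv := congrFun (congrArg PreframeHom.toFun i.inv_hom_id) }
    (PreframeHom.monotone i.hom) (PreframeHom.monotone i.inv)

end KRFrmP

theorem isCMorphism_of_isIso {L M : KRFrmP.{u}} (f : L ⟶ M) [IsIso f] : IsCMorphism f :=
  let e : L ≃o M := KRFrmP.orderIsoOfIso (asIso f)
  ⟨⟨e, fun s => by rw [e.map_sSup, sSup_image]⟩, fun a b => (e.map_sup a b).le,
    fun a b => (e.map_inf a b).ge⟩

/-! ### Round ideals and the well-inside relation -/

namespace RoundIdeal

variable {B : SubS5.{u}}

theorem mem_sup_iff {I J : RoundIdeal B} {a : B} :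
    a ∈ I ⊔ J ↔ ∃ i ∈ I, ∃ j ∈ J, a ≤ i ⊔ j := by
  let K : RoundIdeal B := mk' {a | ∃ i ∈ I, ∃ j ∈ J, a ≤ i ⊔ j}
    ⟨⊥, I.bot_mem, ⊥, J.bot_mem, bot_le⟩
    (fun _ _ h ⟨i, hi, j, hj, hb⟩ => ⟨i, hi, j, hj, h.trans hb⟩)
    (fun _ _ ⟨i, hi, j, hj, ha⟩ ⟨k, hk, l, hl, hb⟩ =>
      ⟨i ⊔ k, I.sup_mem hi hk, j ⊔ l, J.sup_mem hj hl,
        (sup_le_sup ha hb).trans (sup_sup_sup_comm _ _ _ _).le⟩)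
    (by
      rintro a ⟨i, hi, j, hj, ha⟩
      obtain ⟨k, hk, hik⟩ := I.exists_rel hi
      obtain ⟨l, hl, hjl⟩ := J.exists_rel hj
      exact ⟨k ⊔ l, ⟨k, hk, l, hl, le_rfl⟩, B.isS5.mono_left ha (B.isS5.sup_sup hik hjl)⟩)
  have sup_le_K : I ⊔ J ≤ K := sup_le (fun i hi => ⟨i, hi, ⊥, J.bot_mem, le_sup_left⟩)
    (fun j hj => ⟨⊥, I.bot_mem, j, hj, le_sup_right⟩)
  exact ⟨fun h => sup_le_K h, fun ⟨_, hi, _, hj, ha⟩ => mem_of_le _ ha (mem_sup hi hj)⟩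

theorem below_mono : Monotone (below : B → RoundIdeal B) :=
  fun _ _ h _ hx => B.isS5.mono_right hx h

theorem below_le {I : RoundIdeal B} {a : B} (h : a ∈ I) : below a ≤ I :=
  fun _ hx => I.mem_of_le (B.isS5.le _ _ hx) h

theorem below_top : below (⊤ : B) = ⊤ := eq_top_of_top_mem B.isS5.top_top

theorem below_inf (a b : B) : below (a ⊓ b) = below a ⊓ below b :=
  le_antisymm (below_mono.map_inf_le a b) fun _ hx => B.isS5.inf_right _ _ _ hx.1 hx.2

theorem wellInside_iff_exists_below {I J : RoundIdeal B} :
    WellInside I J ↔ ∃ a ∈ J, WellInside I (below a) := by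
  refine ⟨fun h => ?_, fun ⟨a, ha, h⟩ => h.mono le_rfl (below_le ha)⟩
  obtain ⟨i, hi, j, hj, hij⟩ := mem_sup_iff.mp ((show Iᶜ ⊔ J = ⊤ from h).ge (mem_top (a := ⊤)))
  obtain ⟨a, ha, hja⟩ := J.exists_rel hj
  exact ⟨a, ha, eq_top_of_top_mem (mem_sup_iff.mpr ⟨i, hi, j, hja, hij⟩)⟩

theorem exists_isRegular_mem_wellInside {J : RoundIdeal B} {a : B} (h : a ∈ J) :
    ∃ I : RoundIdeal B, Heyting.IsRegular I ∧ a ∈ I ∧ WellInside I J := by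
  obtain ⟨b, hb, hab⟩ := J.exists_rel h
  have below_le_compl_compl : below b ≤ (below b)ᶜᶜ := le_compl_compl
  exact ⟨(below b)ᶜᶜ, Heyting.isRegular_compl _, below_le_compl_compl hab,
    (below_wellInside hb).compl_compl_left⟩

end RoundIdeal

open RoundIdeal

/-! ### The isomorphism `Q` -/

/-- `Q_B` as a morphism of `SubS5^S`. -/
def homQ (B : SubS5.{u}) : B ⟶ boolAlg (RI.obj (op B)) :=
  SubS5.homMk (relQ B)
    { bot_bot := bot_mem _
      top_top := mem_top
      sup_left := fun _ _ I => RoundIdeal.sup_mem (B := B) I.val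
      inf_right := fun _ _ _ h h' => ⟨h, h'⟩
      mono := fun _ _ I _ hab hb hIJ => hIJ (RoundIdeal.mem_of_le (B := B) I.val hab hb) }
    (fun _ I h => by
      obtain ⟨b, hb, hab⟩ := RoundIdeal.exists_rel (B := B) I.val h
      exact ⟨b, hab, hb⟩)
    (fun _ _ h => by
      obtain ⟨I, hI, ha, hIJ⟩ := exists_isRegular_mem_wellInside (B := B) h
      exact ⟨⟨I, hI⟩, ha, hIJ⟩)

/-- The inverse of `Q_B`, relating `I` to `a` iff `I ≺ S⁻¹[a]`. -/
def homQInv (B : SubS5.{u}) : boolAlg (RI.obj (op B)) ⟶ B :=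
  SubS5.homMk (fun I a => WellInside (L := RoundIdeal B) I.val (below a))
    { bot_bot := WellInside.bot_left
      top_top := by
        rw [below_top]
        exact WellInside.top_right
      sup_left := fun _ _ _ h h' => (h.sup_left h').compl_compl_left
      inf_right := fun _ _ _ h h' => by
        rw [below_inf]
        exact h.inf_right h'
      mono := fun _ _ _ _ hIJ h hab => h.mono hIJ (below_mono hab) }
    (fun _ _ h => by
      obtain ⟨J, hJ, hIJ, hJa⟩ := (isCompactRegular B).interpolate h
      exact ⟨⟨J, hJ⟩, hIJ, hJa⟩)
    (fun _ _ h => by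
      obtain ⟨b, hba, hIb⟩ := wellInside_iff_exists_below.mp h
      exact ⟨b, hIb, hba⟩)

/-- `Q_B` as an isomorphism of `SubS5^S`. -/
def isoQ (B : SubS5.{u}) : B ≅ boolAlg (RI.obj (op B)) where
  hom := homQ B
  inv := homQInv B
  hom_inv_id := SubS5.hom_ext fun a b => by
    refine ⟨fun ⟨I, ha, hIb⟩ => hIb.le ha, fun h => ?_⟩
    obtain ⟨I, hI, ha, hIb⟩ := exists_isRegular_mem_wellInside (J := below b) h
    exact ⟨⟨I, hI⟩, ha, hIb⟩
  inv_hom_id := SubS5.hom_ext fun I J => by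
    refine Iff.trans ?_ (wellInside_iff_exists_below (I := I.val) (J := J.val)).symm
    exact exists_congr fun _ => and_comm

theorem homQ_naturality {A B : SubS5.{u}} (T : A ⟶ B) :
    T ≫ homQ B = homQ A ≫ boolMap (RI.map T.op) :=
  SubS5.hom_ext fun a J => by
    refine ⟨fun ⟨b, hab, hb⟩ => ?_, fun ⟨I, ha, hIJ⟩ => ?_⟩
    · obtain ⟨I, hI, ha, hIJ⟩ :=
        exists_isRegular_mem_wellInside (J := preimage T J.val) (a := a) ⟨b, hb, hab⟩
      exact ⟨⟨I, hI⟩, ha, hIJ⟩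
    · obtain ⟨b, hb, hab⟩ := WellInside.le hIJ ha
      exact ⟨b, hab, hb⟩

/-! ### The isomorphism `f` -/

/-- The set `f_L(a)` as a round ideal. -/
def idealF (L : KRFrmP.{u}) (a : L) : RoundIdeal (boolAlg L) :=
  RoundIdeal.mk' (setF L a) WellInside.bot_left (fun _ _ hbc hc => WellInside.mono hbc hc le_rfl)
    (fun _ _ hb hc => (WellInside.sup_left hb hc).compl_compl_left)
    (fun b hb => by
      obtain ⟨c, hc, hbc, hca⟩ := L.isCompactRegular.interpolate (a := b.val) hb
      exact ⟨⟨c, hc⟩, hca, hbc⟩)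

theorem idealF_mono (L : KRFrmP.{u}) : Monotone (idealF L) :=
  fun _ _ h _ hb => WellInside.mono le_rfl hb h

theorem sSup_image_val_idealF (L : KRFrmP.{u}) (a : L) :
    sSup (Heyting.Regular.val '' (idealF L a : Set (boolAlg L))) = a := by
  conv_rhs => rw [← L.isCompactRegular.sSup_regular a]
  refine congrArg sSup (Set.ext fun x => ?_)
  exact ⟨fun ⟨b, hb, hbx⟩ => hbx ▸ ⟨b.prop, hb⟩, fun ⟨hx, hxa⟩ => ⟨⟨x, hx⟩, hxa, rfl⟩⟩

theorem directedOn_image_val {L : KRFrmP.{u}} (I : RoundIdeal (boolAlg L)) :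
    DirectedOn (· ≤ ·) (Heyting.Regular.val '' (I : Set (boolAlg L))) := by
  rintro _ ⟨x, hx, rfl⟩ _ ⟨y, hy, rfl⟩
  have hxy : x ≤ x ⊔ y := le_sup_left
  have hyx : y ≤ x ⊔ y := le_sup_right
  exact ⟨_, ⟨x ⊔ y, I.sup_mem hx hy, rfl⟩, hxy, hyx⟩

theorem idealF_sSup_image_val {L : KRFrmP.{u}} (I : RoundIdeal (boolAlg L)) :
    idealF L (sSup (Heyting.Regular.val '' (I : Set (boolAlg L)))) = I := by
  refine SetLike.ext fun b => ⟨fun h => ?_, fun h => ?_⟩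
  · obtain ⟨_, ⟨c, hc, rfl⟩, hbc⟩ := L.isCompactRegular.exists_of_wellInside_sSup
      (D := Heyting.Regular.val '' (I : Set (boolAlg L))) ⟨_, ⊥, I.bot_mem, rfl⟩
      (directedOn_image_val I) h
    exact I.mem_of_le hbc.le hc
  · obtain ⟨c, hc, hbc⟩ := I.exists_rel h
    exact WellInside.mono le_rfl hbc (le_sSup ⟨c, hc, rfl⟩)

/-- `f_L` as an order isomorphism; its inverse sends a round ideal to its join in `L`. -/
def orderIsoF (L : KRFrmP.{u}) : L ≃o RoundIdeal (boolAlg L) :=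
  Equiv.toOrderIso
    { toFun := idealF L
      invFun := fun I => sSup (Heyting.Regular.val '' (I : Set (boolAlg L)))
      left_inv := sSup_image_val_idealF L
      right_inv := idealF_sSup_image_val }
    (idealF_mono L) fun _ _ h => sSup_le_sSup (Set.image_mono h)

/-- `f_L` as an isomorphism of `KRFrm^P`. -/
def isoF (L : KRFrmP.{u}) : L ≅ RI.obj (op (boolAlg L)) :=
  KRFrmP.isoOfOrderIso (M := RI.obj (op (boolAlg L))) (orderIsoF L)

theorem isoF_naturality {L M : KRFrmP.{u}} (f : L ⟶ M) :
    f ≫ (isoF M).hom = (isoF L).hom ≫ RI.map (boolMap f).op :=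
  KRFrmP.hom_ext fun a => SetLike.ext (A := RoundIdeal (boolAlg M)) fun b => by
    refine ⟨fun h => ?_, fun ⟨c, hca, hbc⟩ => ?_⟩
    · obtain ⟨c, hc, hbc, hca⟩ :=
        L.isCompactRegular.interpolate_map M.isCompactRegular f (b := b.val) h
      exact ⟨⟨c, hc⟩, hca, hbc⟩
    · exact WellInside.mono le_rfl hbc (PreframeHom.monotone f (WellInside.le hca))

theorem RI_map_homQInv (B : SubS5.{u}) :
    RI.map (homQInv B).op = (isoF (RI.obj (op B))).hom :=
  KRFrmP.hom_ext fun I => SetLike.ext (A := RoundIdeal (boolAlg (RI.obj (op B)))) fun _ =>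
    (wellInside_iff_exists_below (J := (I : RoundIdeal B))).symm

/-! ### Continuous subordinations and `c`-morphisms -/

namespace IsContinuous

variable {A B : SubS5.{u}} {T : A ⟶ B}

/-- The operation `◇` of a continuous `T : A → B`: the round ideal of all `x` with `T̂[b] ⊆ S[x]`
for some `b ∈ J`. Continuity is what makes it round. -/
def diamond (hT : IsContinuous T) (J : RoundIdeal B) : RoundIdeal A :=
  RoundIdeal.mk' {x | ∃ b ∈ J, ∀ c, hat T.rel b c → A.S x c}
    ⟨⊥, J.bot_mem, fun _ _ => A.isS5.mono_right A.isS5.bot_bot bot_le⟩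
    (fun _ _ h ⟨b, hb, hx⟩ => ⟨b, hb, fun c hc => A.isS5.mono_left h (hx c hc)⟩)
    (fun _ _ ⟨b, hb, hx⟩ ⟨d, hd, hy⟩ => ⟨b ⊔ d, J.sup_mem hb hd, fun c hc =>
      have hT' := isSubordination_hat T.isSubordination
      A.isS5.sup_left _ _ _ (hx c (hT'.mono_left le_sup_left hc))
        (hy c (hT'.mono_left le_sup_right hc))⟩)
    (by
      rintro x ⟨b, hb, hx⟩
      obtain ⟨d, hd, hbd⟩ := J.exists_rel hb
      obtain ⟨a, hba, hda⟩ := hT _ _ hbd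
      exact ⟨a, ⟨d, hd, hda⟩, hx a hba⟩)

theorem gc_diamond_preimage_hatHom (hT : IsContinuous T) :
    GaloisConnection hT.diamond (preimage (SubS5.hatHom T)) := by
  refine fun J K => ⟨fun h b hb => ?_, ?_⟩
  · obtain ⟨d, hd, hbd⟩ := J.exists_rel hb
    obtain ⟨a, hba, hda⟩ := hT _ _ hbd
    exact ⟨a, h ⟨d, hd, hda⟩, hba⟩
  · rintro h x ⟨b, hb, hx⟩
    obtain ⟨a, ha, hba⟩ := h hb
    exact K.mem_of_le (A.isS5.le _ _ (hx a hba)) ha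

theorem exists_mem_diamond_hat (hT : IsContinuous T) {J : RoundIdeal B} {b : B} (hb : b ∈ J) :
    ∃ a ∈ hT.diamond J, hat T.rel b a :=
  hT.gc_diamond_preimage_hatHom.le_u_l J hb

theorem preimage_sup_le (hT : IsContinuous T) (I J : RoundIdeal B) :
    preimage T (I ⊔ J) ≤ preimage T I ⊔ hT.diamond J := by
  rintro x ⟨b, hb, hxb⟩
  obtain ⟨i, hi, j, hj, hbij⟩ := mem_sup_iff.mp hb
  obtain ⟨a, ha, hja⟩ := hT.exists_mem_diamond_hat hj
  have hxai : T.rel (x ⊓ aᶜ) i :=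
    T.isSubordination.inf_of_sup_of_compl (T.isSubordination.mono_right hxb hbij) hja
  refine mem_sup_iff.mpr ⟨x ⊓ aᶜ, ⟨i, hi, hxai⟩, a, ha, ?_⟩
  rw [← sdiff_eq, sdiff_sup_self]
  exact le_sup_left

theorem preimage_inf_diamond_le (hT : IsContinuous T) (I J : RoundIdeal B) :
    preimage T I ⊓ hT.diamond J ≤ hT.diamond (I ⊓ J) := by
  intro x hx
  obtain ⟨y, ⟨⟨i, hi, hyi⟩, ⟨j, hj, hy⟩⟩, hxy⟩ := RoundIdeal.exists_rel _ hx
  refine ⟨i ⊓ j, ⟨I.mem_of_le inf_le_left hi, J.mem_of_le inf_le_right hj⟩, fun c hc => ?_⟩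
  have hcy : hat T.rel j (cᶜ ⊓ y)ᶜ := by
    rw [hat, compl_compl]
    refine T.isSubordination.inf_of_sup_of_compl (c := iᶜ) ?_ (by rwa [compl_compl])
    rwa [← compl_inf, inf_comm]
  have hyc : y ≤ c := by
    have hle : y ≤ (cᶜ ⊓ y)ᶜ := A.isS5.le _ _ (hy _ hcy)
    rwa [compl_inf, compl_compl, ← himp_eq, le_himp_iff, inf_idem] at hle
  exact A.isS5.mono_right hxy hyc

theorem diamond_sSup (hT : IsContinuous T) (F : Set (RoundIdeal B)) :
    hT.diamond (sSup F) = sSup (hT.diamond '' F) := by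
  rw [hT.gc_diamond_preimage_hatHom.l_sSup, sSup_image]

theorem isCMorphism_RI_map (hT : IsContinuous T) : IsCMorphism (RI.map T.op) :=
  ⟨⟨hT.diamond, hT.diamond_sSup⟩, hT.preimage_sup_le, hT.preimage_inf_diamond_le⟩

end IsContinuous

theorem IsCMorphism.isContinuous_boolMap {L M : KRFrmP.{u}} {f : L ⟶ M} (hf : IsCMorphism f) :
    IsContinuous (boolMap f) := by
  obtain ⟨dia, map_sup_le, map_inf_dia_le⟩ := hf
  intro a b hab
  refine ⟨⟨(dia b.val)ᶜᶜ, Heyting.isRegular_compl _⟩, ?_, fun c hc => ?_⟩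
  · have htop : dia b.val ⊔ PreframeHom.toFun f (a.val)ᶜ = ⊤ := by
      rw [sup_comm]
      refine top_le_iff.mp (le_trans ?_ (map_sup_le _ _))
      rw [show (a.val)ᶜ ⊔ b.val = ⊤ from hab, PreframeHom.map_top f]
    exact (wellInside_compl_of_sup_eq_top htop).compl_compl_left
  · have dia_le : dia b.val ≤ (PreframeHom.toFun f (b.val)ᶜ)ᶜ := by
      rw [le_compl_iff_disjoint_left, disjoint_iff_inf_le]
      refine (map_inf_dia_le _ _).trans ?_
      rw [compl_inf_self, map_bot]
    have hc' : WellInside (PreframeHom.toFun f (b.val)ᶜ)ᶜ (c.val)ᶜᶜ := WellInside.compl hc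
    exact (hc'.mono dia_le c.prop.le).compl_compl_left

/-! ### Restriction of a dual equivalence to wide subcategories -/

section Restriction

variable {C : Type u} [Category.{v} C] {D : Type w} [Category.{v'} D]
  {P : MorphismProperty C} [P.IsMultiplicative] {Q : MorphismProperty D} [Q.IsMultiplicative]

/-- The restriction of a contravariant functor to wide subcategories. -/
def wideFunctor (F : Cᵒᵖ ⥤ D) (hF : P.op ≤ Q.inverseImage F) :
    (WideSubcategory P)ᵒᵖ ⥤ WideSubcategory Q where
  obj X := ⟨F.obj (op X.unop.obj)⟩
  map f := ⟨F.map f.unop.hom.op, hF _ f.unop.property⟩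
  map_id _ := WideSubcategory.hom_ext _ (F.map_id _)
  map_comp f g := WideSubcategory.hom_ext _ (F.map_comp f.unop.hom.op g.unop.hom.op)

/-- The restriction to wide subcategories of a contravariant functor in the other direction. -/
def wideInverse (G : D ⥤ Cᵒᵖ) (hG : Q ≤ P.op.inverseImage G) :
    WideSubcategory Q ⥤ (WideSubcategory P)ᵒᵖ where
  obj Y := op ⟨(G.obj Y.obj).unop⟩
  map g := Quiver.Hom.op ⟨(G.map g.hom).unop, hG _ g.property⟩
  map_id _ := Quiver.Hom.unop_inj (WideSubcategory.hom_ext _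
    (congrArg Quiver.Hom.unop (G.map_id _)))
  map_comp f g := Quiver.Hom.unop_inj (WideSubcategory.hom_ext _
    (congrArg Quiver.Hom.unop (G.map_comp f.hom g.hom)))

variable (e : Cᵒᵖ ≌ D) (hF : P.op ≤ Q.inverseImage e.functor)
  (hG : Q ≤ P.op.inverseImage e.inverse) (hP : MorphismProperty.isomorphisms C ≤ P)
  (hQ : MorphismProperty.isomorphisms D ≤ Q)

/-- The restriction of a dual equivalence to wide subcategories that contain all isomorphisms. -/
def wideEquivalence : (WideSubcategory P)ᵒᵖ ≌ WideSubcategory Q where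
  functor := wideFunctor e.functor hF
  inverse := wideInverse e.inverse hG
  unitIso := NatIso.ofComponents
    (fun X => (WideSubcategory.isoMk (X := ⟨(e.inverse.obj (e.functor.obj (op X.unop.obj))).unop⟩)
      (Y := X.unop) (e.unitIso.app (op X.unop.obj)).unop
      (hP _ (inferInstanceAs (IsIso _))) (hP _ (inferInstanceAs (IsIso _)))).op)
    fun f => Quiver.Hom.unop_inj (WideSubcategory.hom_ext _
      (congrArg Quiver.Hom.unop (e.unitIso.hom.naturality f.unop.hom.op)))
  counitIso := NatIso.ofComponents
    (fun Y => WideSubcategory.isoMk (X := ⟨e.functor.obj (e.inverse.obj Y.obj)⟩) (Y := Y)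
      (e.counitIso.app Y.obj)
      (hQ _ (inferInstanceAs (IsIso _))) (hQ _ (inferInstanceAs (IsIso _))))
    fun g => WideSubcategory.hom_ext _ (e.counitIso.hom.naturality g.hom)
  functor_unitIso_comp X := WideSubcategory.hom_ext _ (e.functor_unitIso_comp (op X.unop.obj))

theorem restrictsTo_wideEquivalence :
    RestrictsTo e (wideEquivalence e hF hG hP hQ) (wideSubcategoryInclusion P).op
      (wideSubcategoryInclusion Q) where
  functor_eq := rfl
  inverse_eq := rfl
  unit_eq _ := Category.comp_id _
  counit_eq _ := (Category.id_comp _).symm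

end Restriction

/-! ### The dual equivalences -/

/-- The unit of the dual equivalence between `SubS5^S` and `KRFrm^P`. -/
def unitSubS5 : 𝟭 SubS5.{u}ᵒᵖ ≅ RI ⋙ boolFunctor.rightOp ⋙ inclΔ.op :=
  (NatIso.ofComponents (F := RI ⋙ boolFunctor.rightOp ⋙ inclΔ.op) (G := 𝟭 SubS5.{u}ᵒᵖ)
    (fun B => (isoQ B.unop).op)
    fun T => Quiver.Hom.unop_inj (homQ_naturality T.unop).symm).symm

/-- The unit of the dual equivalence between `DeV^S` and `KRFrm^P`. -/
def unitDeV : 𝟭 DeVS.{u}ᵒᵖ ≅ (inclΔ.op ⋙ RI) ⋙ boolFunctor.rightOp :=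
  (NatIso.ofComponents (F := (inclΔ.op ⋙ RI) ⋙ boolFunctor.rightOp) (G := 𝟭 DeVS.{u}ᵒᵖ)
    (fun B => (IsDeVries.isoMk (X := B.unop)
      (Y := boolFunctor.obj (op (RI.obj (op B.unop.obj)))) (isoQ B.unop.obj)).op)
    fun T => Quiver.Hom.unop_inj
      (ObjectProperty.hom_ext _ (homQ_naturality T.unop.hom).symm)).symm

/-- The common counit of the two dual equivalences. -/
def counitRI : (boolFunctor.rightOp ⋙ inclΔ.op) ⋙ RI ≅ 𝟭 KRFrmP.{u} :=
  (NatIso.ofComponents (F := 𝟭 KRFrmP.{u}) (G := (boolFunctor.rightOp ⋙ inclΔ.op) ⋙ RI)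
    isoF isoF_naturality).symm

theorem RI_map_homQInv_comp_isoF_inv (B : SubS5.{u}) :
    RI.map (homQInv B).op ≫ (isoF (RI.obj (op B))).inv = 𝟙 (RI.obj (op B)) := by
  rw [RI_map_homQInv, Iso.hom_inv_id]

end S5Sub

open S5Sub

theorem mainTheorem4 :
    (∃ (η : 𝟭 SubS5.{u}ᵒᵖ ≅ RI ⋙ boolFunctor.rightOp ⋙ inclΔ.op)
        (ε : (boolFunctor.rightOp ⋙ inclΔ.op) ⋙ RI ≅ 𝟭 KRFrmP.{u})
        (tri : ∀ B, RI.map (η.hom.app B) ≫ ε.hom.app (RI.obj B) = 𝟙 (RI.obj B)),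
      (∀ B : SubS5.{u}, (η.inv.app (op B)).unop.rel = relQ B) ∧
      (∀ (L : KRFrmP.{u}) (a : L),
        ((PreframeHom.toFun (ε.inv.app L) a : RoundIdeal (boolAlg L)) : Set (boolAlg L)) =
          setF L a) ∧
      ∃ e : SubS5CS.{u}ᵒᵖ ≌ KRFrmC.{u},
        RestrictsTo (Equivalence.mk' RI (boolFunctor.rightOp ⋙ inclΔ.op) η ε tri) e
          (wideSubcategoryInclusion IsContinuous).op (wideSubcategoryInclusion IsCMorphism)) ∧
    (∃ (η : 𝟭 DeVS.{u}ᵒᵖ ≅ (inclΔ.op ⋙ RI) ⋙ boolFunctor.rightOp)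
        (ε : boolFunctor.rightOp ⋙ inclΔ.op ⋙ RI ≅ 𝟭 KRFrmP.{u})
        (tri : ∀ B, (inclΔ.op ⋙ RI).map (η.hom.app B) ≫ ε.hom.app ((inclΔ.op ⋙ RI).obj B) =
          𝟙 ((inclΔ.op ⋙ RI).obj B)),
      (∀ B : DeVS.{u}, (η.inv.app (op B)).unop.hom.rel = relQ B.obj) ∧
      (∀ (L : KRFrmP.{u}) (a : L),
        ((PreframeHom.toFun (ε.inv.app L) a : RoundIdeal (boolAlg L)) : Set (boolAlg L)) =
          setF L a) ∧
      ∃ e : DeVCS.{u}ᵒᵖ ≌ KRFrmC.{u},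
        RestrictsTo (Equivalence.mk' (inclΔ.op ⋙ RI) boolFunctor.rightOp η ε tri) e
          (wideSubcategoryInclusion IsContinuousDeV).op
          (wideSubcategoryInclusion IsCMorphism)) := by
  refine ⟨⟨unitSubS5, counitRI, fun B => RI_map_homQInv_comp_isoF_inv B.unop, fun _ => rfl,
    fun _ _ => rfl, _, restrictsTo_wideEquivalence _ ?_ ?_ ?_ ?_⟩,
    ⟨unitDeV, counitRI, fun B => RI_map_homQInv_comp_isoF_inv B.unop.obj, fun _ => rfl,
    fun _ _ => rfl, _, restrictsTo_wideEquivalence _ ?_ ?_ ?_ ?_⟩⟩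
  · exact fun _ _ _ hT => IsContinuous.isCMorphism_RI_map hT
  · exact fun _ _ _ hf => IsCMorphism.isContinuous_boolMap hf
  · exact fun _ _ T (_ : IsIso T) => isContinuous_of_isIso T
  · exact fun _ _ f (_ : IsIso f) => isCMorphism_of_isIso f
  · exact fun _ _ _ hT => IsContinuous.isCMorphism_RI_map hT
  · exact fun _ _ _ hf => IsCMorphism.isContinuous_boolMap hf
  · exact fun _ _ T (_ : IsIso T) => isContinuous_of_isIso T.hom
  · exact fun _ _ f (_ : IsIso f) => isCMorphism_of_isIso f
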